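/- Let $D$ be a connected, loopless, finite multi-digraph with at least one edge. A closed trail of $D$ is a closed directed walk $\mathbf{w}=(v_0,e_1,v_1,\ldots,e_d,v_d=v_0)$, $d\ge 0$, with distinct edges; it is at $u$ if $v_0=u$, ends at the edge $e$ if $e_d=e$, and is Eulerian if it uses every edge of $D$. Assume that $D$ is Eulerian, i.e. has an Eulerian closed trail. A cycle of $D$ is a closed trail of positive length with $v_1,\ldots,v_d$ distinct, taken up to cyclic permutation of its edges. Let $\mathcal{B}(D)$ be the set of cycles; two cycles are concurrent if they share a vertex. A heap on $D$ is a finite poset $(\Omega,\le)$ with a labelling $\ell:\Omega\to\mathcal{B}(D)$ such that elements with concurrent labels are comparable, and if $y$ covers $x$ then $\ell(x),\ell(y)$ are concurrent; heaps are considered up to label-preserving isomorphism. The composition $H_1\circ H_2$ has as ground set the disjoint union $\Omega_1\sqcup\Omega_2$, the labels of $H_1$ and $H_2$, and as order the transitive closure of $\le_1$, $\le_2$ and the relations $x\le y$ for $x\in\Omega_1$, $y\in\Omega_2$ with concurrent labels. A single cycle is viewed as a one-element heap. A pyramid is a heap with exactly one maximal element. A decomposition pyramid is a pyramid such that the edge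 sets $E(\ell(x))$, $x\in\Omega$, partition $E(D)$. The cycle sequence $(\beta_1,\ldots,\beta_m)$ of a closed trail $\mathbf{w}$ is defined recursively: it is empty if $\mathbf{w}$ has length $0$; otherwise let $t$ be minimal such that $v_t=v_s$ for some $s<t$ (this $s$ is then unique), let $\beta_1$ be the class of $(v_s,e_{s+1},\ldots,e_t,v_t)$, and let $(\beta_2,\ldots,\beta_m)$ be the cycle sequence of the remainder $(v_0,e_1,\ldots,e_s,v_s,e_{t+1},\ldots,e_d,v_d)$. Put $g(\mathbf{w})=\beta_1\circ\cdots\circ\beta_m$. Then $g(\mathbf{w})$ is a pyramid for every closed trail $\mathbf{w}$ of positive length, and: 1. for every edge $e$, $g$ restricts to a bijection from the set of Eulerian closed trails of $D$ ending at $e$ onto the set of decomposition pyramids of $D$ whose maximal piece contains $e$; 2. for every vertex $u$, $g$ restricts to a bijection from the set of Eulerian closed trails of $D$ at $u$ onto the set of decomposition pyramids of $D$ whose maximal piece contains $u$. -/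

import Mathlib

/-! ### Heaps of pieces -/

/-- A concurrence relation on a set `B` of pieces: reflexive and symmetric. -/
structure Concurrence (B : Type*) where
  Rel : B → B → Prop
  refl : ∀ a, Rel a a
  symm : ∀ a b, Rel a b → Rel b a

/-- A heap `(Ω, ≤, ℓ)` of pieces of `B`: a finite poset labelled by `B` in which elements with
concurrent labels are comparable and in which the labels of a covering pair are concurrent. -/
structure LabelledHeap {B : Type*} (R : Concurrence B) where
  Ω : Type
  [order : PartialOrder Ω]
  [finite : Finite Ω]
  label : Ω → B
  comparable : ∀ x y, R.Rel (label x) (label y) → x ≤ y ∨ y ≤ x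
  concurrent : ∀ x y, x ⋖ y → R.Rel (label x) (label y)

namespace LabelledHeap

attribute [instance] LabelledHeap.order LabelledHeap.finite

variable {B : Type*} {R : Concurrence B}

/-- The generating relations of the order on the disjoint union of two heaps:
the orders of the two heaps, and `v₁ ≤ v₂` for concurrent `v₁ ∈ H₁`, `v₂ ∈ H₂`. -/
inductive CompGen (H₁ H₂ : LabelledHeap R) : H₁.Ω ⊕ H₂.Ω → H₁.Ω ⊕ H₂.Ω → Prop
  | left {x y : H₁.Ω} : x ≤ y → CompGen H₁ H₂ (Sum.inl x) (Sum.inl y)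
  | right {x y : H₂.Ω} : x ≤ y → CompGen H₁ H₂ (Sum.inr x) (Sum.inr y)
  | cross {x : H₁.Ω} {y : H₂.Ω} : R.Rel (H₁.label x) (H₂.label y) →
      CompGen H₁ H₂ (Sum.inl x) (Sum.inr y)

/-- The order on the composition: the transitive closure of the generating relations. -/
def CompLE (H₁ H₂ : LabelledHeap R) : H₁.Ω ⊕ H₂.Ω → H₁.Ω ⊕ H₂.Ω → Prop :=
  Relation.TransGen (CompGen H₁ H₂)

theorem compLE_inl_inl (H₁ H₂ : LabelledHeap R) {a : H₁.Ω ⊕ H₂.Ω} {y : H₁.Ω}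
    (h : CompLE H₁ H₂ a (Sum.inl y)) : ∃ x, a = Sum.inl x ∧ x ≤ y := by
  generalize hb : (Sum.inl y : H₁.Ω ⊕ H₂.Ω) = b at h
  induction h generalizing y with
  | single h =>
    subst hb
    cases h with
    | left h => exact ⟨_, rfl, h⟩
  | tail _ h ih =>
    subst hb
    cases h with
    | left h =>
      obtain ⟨x, hx, hxy⟩ := ih rfl
      exact ⟨x, hx, hxy.trans h⟩

theorem compLE_inr_inr (H₁ H₂ : LabelledHeap R) {x : H₂.Ω} {b : H₁.Ω ⊕ H₂.Ω}
    (h : CompLE H₁ H₂ (Sum.inr x) b) : ∃ y, b = Sum.inr y ∧ x ≤ y := by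
  induction h with
  | single h =>
    cases h with
    | right h => exact ⟨_, rfl, h⟩
  | tail _ h ih =>
    obtain ⟨y, rfl, hxy⟩ := ih
    cases h with
    | right h => exact ⟨_, rfl, hxy.trans h⟩

theorem compLE_antisymm (H₁ H₂ : LabelledHeap R) (a b : H₁.Ω ⊕ H₂.Ω)
    (h : CompLE H₁ H₂ a b) (h' : CompLE H₁ H₂ b a) : a = b := by
  cases b with
  | inl y =>
    obtain ⟨x, rfl, hxy⟩ := compLE_inl_inl H₁ H₂ h
    obtain ⟨z, hz, hzx⟩ := compLE_inl_inl H₁ H₂ h'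
    cases hz
    rw [le_antisymm hxy hzx]
  | inr y =>
    obtain ⟨x, rfl, hxy⟩ := compLE_inr_inr H₁ H₂ h'
    obtain ⟨z, hz, hzx⟩ := compLE_inr_inr H₁ H₂ h
    cases hz
    rw [le_antisymm hxy hzx]

/-- The partial order of the composition of two heaps. -/
@[reducible] def compOrder (H₁ H₂ : LabelledHeap R) : PartialOrder (H₁.Ω ⊕ H₂.Ω) where
  le := CompLE H₁ H₂
  lt a b := CompLE H₁ H₂ a b ∧ ¬ CompLE H₁ H₂ b a
  le_refl a := by
    cases a with
    | inl x => exact .single (.left le_rfl)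
    | inr x => exact .single (.right le_rfl)
  le_trans _ _ _ h h' := Relation.TransGen.trans h h'
  le_antisymm := compLE_antisymm H₁ H₂

theorem comp_concurrent (H₁ H₂ : LabelledHeap R) (a b : H₁.Ω ⊕ H₂.Ω)
    (hlt : CompLE H₁ H₂ a b) (hne : a ≠ b)
    (hcov : ∀ c, CompLE H₁ H₂ a c → CompLE H₁ H₂ c b → c = a ∨ c = b) :
    R.Rel (Sum.elim H₁.label H₂.label a) (Sum.elim H₁.label H₂.label b) := by
  have key : ∀ a b : H₁.Ω ⊕ H₂.Ω, CompGen H₁ H₂ a b → a ≠ b →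
      (∀ c, CompLE H₁ H₂ a c → CompLE H₁ H₂ c b → c = a ∨ c = b) →
      R.Rel (Sum.elim H₁.label H₂.label a) (Sum.elim H₁.label H₂.label b) := by
    intro a b h hne hcov
    cases h with
    | @left x y h =>
      refine H₁.concurrent x y ⟨lt_of_le_of_ne h fun e => hne (by rw [e]), fun z hz hz' => ?_⟩
      rcases hcov (Sum.inl z) (.single (.left hz.le)) (.single (.left hz'.le)) with e | e
      · exact hz.ne' (Sum.inl.inj e)
      · exact hz'.ne (Sum.inl.inj e)
    | @right x y h =>
      refine H₂.concurrent x y ⟨lt_of_le_of_ne h fun e => hne (by rw [e]), fun z hz hz' => ?_⟩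
      rcases hcov (Sum.inr z) (.single (.right hz.le)) (.single (.right hz'.le)) with e | e
      · exact hz.ne' (Sum.inr.inj e)
      · exact hz'.ne (Sum.inr.inj e)
    | cross h => exact h
  induction hlt with
  | single h => exact key _ _ h hne hcov
  | @tail c b hac hcb ih =>
    rcases hcov c hac (.single hcb) with e | e
    · subst e
      exact key _ _ hcb hne hcov
    · subst e
      exact ih hne hcov

/-- The composition `H₁ ∘ H₂` of two heaps, on the disjoint union of the ground sets. -/
def comp (H₁ H₂ : LabelledHeap R) : LabelledHeap R where
  Ω := H₁.Ω ⊕ H₂.Ω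
  order := compOrder H₁ H₂
  label := Sum.elim H₁.label H₂.label
  comparable := by
    rintro (x | x) (y | y) h
    · exact (H₁.comparable x y h).imp (fun h => .single (.left h)) (fun h => .single (.left h))
    · exact Or.inl (.single (.cross h))
    · exact Or.inr (.single (.cross (R.symm _ _ h)))
    · exact (H₂.comparable x y h).imp (fun h => .single (.right h)) (fun h => .single (.right h))
  concurrent := by
    intro a b h
    exact comp_concurrent H₁ H₂ a b h.1.1 (fun e => h.1.2 (e ▸ h.1.1)) fun c hac hcb =>
      @CovBy.eq_or_eq _ (compOrder H₁ H₂) a b c h hac hcb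

/-- The heap without pieces. -/
def empty (R : Concurrence B) : LabelledHeap R where
  Ω := Empty
  label := nofun
  comparable := nofun
  concurrent := nofun

/-- The heap with the single piece `b`. -/
def single (R : Concurrence B) (b : B) : LabelledHeap R where
  Ω := Unit
  label := fun _ => b
  comparable := fun _ _ _ => Or.inl le_rfl
  concurrent := fun _ _ _ => R.refl b

/-- `β₁ ∘ (β₂ ∘ (⋯ ∘ βₘ))`. -/
def compList (R : Concurrence B) : List B → LabelledHeap R
  | [] => empty R
  | b :: L => (single R b).comp (compList R L)

/-- Isomorphism of heaps: an order isomorphism that preserves the labels. -/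
def Iso (H₁ H₂ : LabelledHeap R) : Prop :=
  ∃ φ : H₁.Ω ≃o H₂.Ω, ∀ x, H₂.label (φ x) = H₁.label x

instance isoSetoid (R : Concurrence B) : Setoid (LabelledHeap R) where
  r := Iso
  iseqv :=
    { refl := fun H => ⟨OrderIso.refl _, fun _ => rfl⟩
      symm := by
        rintro H₁ H₂ ⟨φ, h⟩
        exact ⟨φ.symm, fun x => by rw [← h, φ.apply_symm_apply]⟩
      trans := by
        rintro H₁ H₂ H₃ ⟨φ, h⟩ ⟨χ, h'⟩
        exact ⟨φ.trans χ, fun x => (h' _).trans (h x)⟩ }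

/-- The set `𝓜(H)` of maximal elements. -/
def maximals (H : LabelledHeap R) : Set H.Ω := {x | IsMax x}

/-- `H` is a pyramid: it has exactly one maximal element. -/
def IsPyramid (H : LabelledHeap R) : Prop := ∃ x, H.maximals = {x}

/-- `H` is a pyramid and the label of its maximal element lies in `S`. -/
def IsPyramidWithMaxIn (H : LabelledHeap R) (S : Set B) : Prop :=
  ∃ x, H.maximals = {x} ∧ H.label x ∈ S

end LabelledHeap

/-- `𝕙(B, R)`: heaps up to isomorphism. -/
def Heaps {B : Type*} (R : Concurrence B) : Type _ := Quotient (LabelledHeap.isoSetoid R)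

/-- The isomorphism class of a heap. -/
def Heaps.mk {B : Type*} {R : Concurrence B} (H : LabelledHeap R) : Heaps R :=
  Quotient.mk (LabelledHeap.isoSetoid R) H

/-- `𝕡(B, R)`: the pyramids, up to isomorphism. -/
def pyramids {B : Type*} (R : Concurrence B) : Set (Heaps R) :=
  {P | ∃ H : LabelledHeap R, Heaps.mk H = P ∧ H.IsPyramid}

/-! ### Multi-digraphs and closed trails -/

/-- A loopless multi-digraph with vertex set `V` and edge set `E`; the edge `e` goes from `src e`
to `tgt e`. -/
structure MultiDigraph (V E : Type*) where
  src : E → V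
  tgt : E → V
  loopless : ∀ e, src e ≠ tgt e

namespace MultiDigraph

variable {V E : Type*} (D : MultiDigraph V E)

/-- `D.IsWalk u l v`: the edges of `l`, in this order, form a walk from `u` to `v`. -/
def IsWalk : V → List E → V → Prop
  | u, [], v => u = v
  | u, e :: l, v => D.src e = u ∧ IsWalk (D.tgt e) l v

/-- `D` is connected: any two vertices are joined by a sequence of edges, irrespective of their
directions. -/
def Connected : Prop :=
  Nonempty V ∧ ∀ u v, Relation.EqvGen (fun a b => ∃ e, D.src e = a ∧ D.tgt e = b) u v

/-- A closed trail `(v₀, e₁, v₁, …, e_d, v_d = v₀)`, given by `v₀` and by its distinct edges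
`e₁, …, e_d`; these determine `vᵢ`, the end of `eᵢ`. -/
@[ext] structure ClosedTrail where
  base : V
  edges : List E
  isWalk : D.IsWalk base edges base
  nodup : edges.Nodup

/-- The vertices `v₀, v₁, …` met along the edges of `l`, starting at `u` (`u` beyond the end). -/
def vertexAt (u : V) (l : List E) (i : ℕ) : V := (u :: l.map D.tgt).getD i u

/-- `t` is a repeated index: `v_t = v_s` for some earlier index `s`. -/
def IsRepeated (u : V) (l : List E) (t : ℕ) : Prop :=
  t ≤ l.length ∧ ∃ s < t, D.vertexAt u l s = D.vertexAt u l t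

variable {D}

theorem isWalk_append {u v : V} {l l' : List E} :
    D.IsWalk u (l ++ l') v ↔ ∃ x, D.IsWalk u l x ∧ D.IsWalk x l' v := by
  induction l generalizing u with
  | nil => simp [IsWalk]
  | cons e l ih => simp [IsWalk, ih, and_assoc]

theorem IsWalk.take {u v : V} {l : List E} (h : D.IsWalk u l v) {i : ℕ} (hi : i ≤ l.length) :
    D.IsWalk u (l.take i) (D.vertexAt u l i) := by
  have aux : ∀ (l : List E) (u d : V) (i : ℕ), D.IsWalk u l v → i ≤ l.length →
      D.IsWalk u (l.take i) ((u :: l.map D.tgt).getD i d) := by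
    intro l
    induction l with
    | nil => intro u d i _ hi; simp at hi; subst hi; simp [IsWalk]
    | cons e l ih =>
      intro u d i h hi
      cases i with
      | zero => simp [IsWalk]
      | succ i => exact ⟨h.1, by simpa using ih (D.tgt e) d i h.2 (by simpa using hi)⟩
  exact aux l u u i h hi

theorem IsWalk.drop {u v : V} {l : List E} (h : D.IsWalk u l v) {i : ℕ} (hi : i ≤ l.length) :
    D.IsWalk (D.vertexAt u l i) (l.drop i) v := by
  have aux : ∀ (l : List E) (u d : V) (i : ℕ), D.IsWalk u l v → i ≤ l.length →
      D.IsWalk ((u :: l.map D.tgt).getD i d) (l.drop i) v := by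
    intro l
    induction l with
    | nil => intro u d i h hi; simp at hi; subst hi; simpa using h
    | cons e l ih =>
      intro u d i h hi
      cases i with
      | zero => simpa using h
      | succ i => simpa using ih (D.tgt e) d i h.2 (by simpa using hi)
  exact aux l u u i h hi

theorem IsWalk.unique {u v v' : V} {l : List E} (h : D.IsWalk u l v) (h' : D.IsWalk u l v') :
    v = v' := by
  induction l generalizing u with
  | nil => exact h.symm.trans h'
  | cons e l ih => exact ih h.2 h'.2

theorem IsWalk.vertexAt_length {u v : V} {l : List E} (h : D.IsWalk u l v) :
    D.vertexAt u l l.length = v := by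
  have := h.take le_rfl
  rw [List.take_length] at this
  exact this.unique h

/-! ### Cycles -/

namespace ClosedTrail

/-- A simple closed trail: of positive length, and `v₁, …, v_d = v₀` are distinct. -/
def IsSimple (w : D.ClosedTrail) : Prop :=
  w.edges ≠ [] ∧ (w.edges.map D.tgt).Nodup

/-- A closed trail is Eulerian if it uses every edge. -/
def IsEulerian (w : D.ClosedTrail) : Prop := ∀ e, e ∈ w.edges

end ClosedTrail

variable (D)

/-- `𝓑(D)`: the cycles of `D`, i.e. the simple closed trails up to cyclic permutation of the
edges. (`Cycle E` is the type of lists over `E` modulo rotation.) -/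
def Piece : Type _ :=
  {c : Cycle E // ∃ w : D.ClosedTrail, w.IsSimple ∧ (w.edges : Cycle E) = c}

variable {D}

/-- The edge set of a cycle. -/
def Piece.edgeSet (β : D.Piece) : Set E := {e | e ∈ β.1}

/-- The vertex set of a cycle. -/
def Piece.vertexSet (β : D.Piece) : Set V := {v | ∃ e ∈ β.1, D.tgt e = v}

theorem Piece.vertexSet_nonempty (β : D.Piece) : β.vertexSet.Nonempty := by
  obtain ⟨c, w, ⟨hw, _⟩, rfl⟩ := β
  obtain ⟨e, he⟩ := List.exists_mem_of_ne_nil _ hw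
  exact ⟨D.tgt e, e, Cycle.mem_coe_iff.2 he, rfl⟩

variable (D)

/-- Two cycles are concurrent if they share a vertex. -/
def concurrence : Concurrence D.Piece where
  Rel β γ := (β.vertexSet ∩ γ.vertexSet).Nonempty
  refl β := by simpa using β.vertexSet_nonempty
  symm β γ h := by rwa [Set.inter_comm]

variable {D}

/-! ### The cycle sequence of a closed trail -/

namespace ClosedTrail

theorem exists_isRepeated (w : D.ClosedTrail) (hw : w.edges ≠ []) :
    ∃ t, D.IsRepeated w.base w.edges t :=
  ⟨w.edges.length, le_rfl, 0, List.length_pos_iff.2 hw, by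
    rw [w.isWalk.vertexAt_length]; simp [vertexAt]⟩

open Classical in
/-- The minimum repeated index `t` of a closed trail of positive length. -/
noncomputable def t (w : D.ClosedTrail) (hw : w.edges ≠ []) : ℕ :=
  Nat.find (w.exists_isRepeated hw)

theorem t_spec (w : D.ClosedTrail) (hw : w.edges ≠ []) :
    D.IsRepeated w.base w.edges (w.t hw) := by
  classical
  exact Nat.find_spec (w.exists_isRepeated hw)

theorem t_min (w : D.ClosedTrail) (hw : w.edges ≠ []) {i : ℕ} (hi : i < w.t hw) :
    ¬ D.IsRepeated w.base w.edges i := by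
  classical
  exact Nat.find_min (w.exists_isRepeated hw) hi

/-- The (unique) index `s < t` with `v_s = v_t`. -/
noncomputable def s (w : D.ClosedTrail) (hw : w.edges ≠ []) : ℕ :=
  (w.t_spec hw).2.choose

theorem s_lt_t (w : D.ClosedTrail) (hw : w.edges ≠ []) : w.s hw < w.t hw :=
  (w.t_spec hw).2.choose_spec.1

theorem vertexAt_s (w : D.ClosedTrail) (hw : w.edges ≠ []) :
    D.vertexAt w.base w.edges (w.s hw) = D.vertexAt w.base w.edges (w.t hw) :=
  (w.t_spec hw).2.choose_spec.2

theorem t_le_length (w : D.ClosedTrail) (hw : w.edges ≠ []) : w.t hw ≤ w.edges.length :=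
  (w.t_spec hw).1

theorem s_le_length (w : D.ClosedTrail) (hw : w.edges ≠ []) : w.s hw ≤ w.edges.length :=
  (w.s_lt_t hw).le.trans (w.t_le_length hw)

/-- The first simple closed subtrail `(v_s, e_{s+1}, …, e_t, v_t)`. -/
noncomputable def firstLoop (w : D.ClosedTrail) (hw : w.edges ≠ []) : D.ClosedTrail where
  base := D.vertexAt w.base w.edges (w.s hw)
  edges := (w.edges.take (w.t hw)).drop (w.s hw)
  isWalk := by
    have h := w.isWalk.take (w.t_le_length hw)
    have hs : w.s hw ≤ (w.edges.take (w.t hw)).length := by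
      simp [(w.s_lt_t hw).le, w.s_le_length hw]
    have h' := h.take hs
    rw [List.take_take, min_eq_left (w.s_lt_t hw).le] at h'
    have e := h'.unique (w.isWalk.take (w.s_le_length hw))
    have h'' := h.drop hs
    rw [e, ← w.vertexAt_s hw] at h''
    exact h''
  nodup := (w.nodup.sublist (List.take_sublist _ _)).sublist (List.drop_sublist _ _)

theorem firstLoop_isSimple (w : D.ClosedTrail) (hw : w.edges ≠ []) :
    (w.firstLoop hw).IsSimple := by
  have hst := w.s_lt_t hw
  have htl := w.t_le_length hw
  have hlen : (w.firstLoop hw).edges.length = w.t hw - w.s hw := by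
    simp [firstLoop, htl]
  refine ⟨?_, ?_⟩
  · rw [← List.length_pos_iff, hlen]
    omega
  · have key : ∀ i j, w.s hw < i → i < j → j ≤ w.t hw →
        D.vertexAt w.base w.edges i ≠ D.vertexAt w.base w.edges j := by
      intro i j hi hij hj heq
      rcases hj.lt_or_eq with hj' | rfl
      · exact w.t_min hw hj' ⟨by omega, i, hij, heq⟩
      · exact w.t_min hw hij ⟨by omega, _, hi, (w.vertexAt_s hw).trans heq.symm⟩
    have hv : ∀ (k : ℕ) (hk : k < w.edges.length),
        D.vertexAt w.base w.edges (k + 1) = D.tgt w.edges[k] := by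
      intro k hk
      simp [vertexAt, hk]
    rw [List.nodup_iff_pairwise_ne, List.pairwise_iff_getElem]
    intro i j hi hj hij
    rw [List.length_map, hlen] at hi hj
    have := key (w.s hw + i + 1) (w.s hw + j + 1) (by omega) (by omega) (by omega)
    rw [hv _ (by omega), hv _ (by omega)] at this
    simpa [firstLoop] using this

/-- The remainder `(v₀, e₁, …, e_s, v_s, e_{t+1}, …, v_d)` of a closed trail after removal of its
first simple closed subtrail. -/
noncomputable def remainder (w : D.ClosedTrail) (hw : w.edges ≠ []) : D.ClosedTrail where
  base := w.base
  edges := w.edges.take (w.s hw) ++ w.edges.drop (w.t hw)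
  isWalk := by
    refine isWalk_append.2 ⟨_, w.isWalk.take (w.s_le_length hw), ?_⟩
    rw [w.vertexAt_s hw]
    exact w.isWalk.drop (w.t_le_length hw)
  nodup := by
    refine w.nodup.sublist ?_
    have h := (List.take_sublist_take_left (l := w.edges) (w.s_lt_t hw).le).append
      (List.Sublist.refl (w.edges.drop (w.t hw)))
    rwa [List.take_append_drop] at h

theorem remainder_length_lt (w : D.ClosedTrail) (hw : w.edges ≠ []) :
    (w.remainder hw).edges.length < w.edges.length := by
  have h1 := w.s_lt_t hw
  have h2 := w.t_le_length hw
  simp only [remainder, List.length_append, List.length_take, List.length_drop]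
  omega

/-- The class of a simple closed trail under cyclic permutation of the edges. -/
def toPiece (w : D.ClosedTrail) (hw : w.IsSimple) : D.Piece := ⟨(w.edges : Cycle E), w, hw, rfl⟩

open Classical in
/-- The cycle sequence `cs(w) = (β₁, …, βₘ)`: repeatedly remove the first simple closed subtrail
and record its class; `cs` of a trail of length `0` is empty. -/
noncomputable def cycleSeq (w : D.ClosedTrail) : List D.Piece :=
  if hw : w.edges = [] then []
  else (w.firstLoop hw).toPiece (w.firstLoop_isSimple hw) :: cycleSeq (w.remainder hw)
termination_by w.edges.length
decreasing_by exact w.remainder_length_lt hw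

/-- `g(w) = β₁ ∘ ⋯ ∘ βₘ`, where `(β₁, …, βₘ)` is the cycle sequence of `w`. -/
noncomputable def toHeap (w : D.ClosedTrail) : Heaps D.concurrence :=
  Heaps.mk (LabelledHeap.compList D.concurrence w.cycleSeq)

end ClosedTrail

/-! ### Eulerian trails and decomposition pyramids -/

variable (D)

/-- `D` is Eulerian if it has an Eulerian closed trail. -/
def Eulerian : Prop := ∃ w : D.ClosedTrail, w.IsEulerian

/-- `𝓦ᵉ(D)`: the Eulerian closed trails whose last edge is `e`. -/
def eulerianTrailsEndingAt (e : E) : Set D.ClosedTrail :=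
  {w | w.IsEulerian ∧ w.edges.getLast? = some e}

/-- `𝓦ᵘ(D)`: the Eulerian closed trails that start and end at `u`. -/
def eulerianTrailsAt (u : V) : Set D.ClosedTrail :=
  {w | w.IsEulerian ∧ w.base = u}

variable {D}

/-- The edge sets of the pieces of `H` partition the edge set of `D`. -/
def IsDecomposition (H : LabelledHeap D.concurrence) : Prop :=
  ∀ e : E, ∃! x : H.Ω, e ∈ (H.label x).edgeSet

variable (D)

/-- The decomposition pyramids (up to isomorphism) whose maximal piece contains the edge `e`. -/
def decompositionPyramidsEdge (e : E) : Set (Heaps D.concurrence) :=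
  {P | ∃ H : LabelledHeap D.concurrence, Heaps.mk H = P ∧ IsDecomposition H ∧
    H.IsPyramidWithMaxIn {β | e ∈ β.edgeSet}}

/-- The decomposition pyramids (up to isomorphism) whose maximal piece contains the vertex `u`. -/
def decompositionPyramidsVertex (u : V) : Set (Heaps D.concurrence) :=
  {P | ∃ H : LabelledHeap D.concurrence, Heaps.mk H = P ∧ IsDecomposition H ∧
    H.IsPyramidWithMaxIn {β | u ∈ β.vertexSet}}

end MultiDigraph

/-!
The map `g` is inverted by running the recursion for the cycle sequence backwards.

*One step of the recursion.* Up to its first repeated vertex, a closed trail runs along a *lasso*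
`a ++ b`: a path `a` followed by a loop `b` (`IsLasso`). The recursion removes `b`, whose cycle
`β` becomes the bottom piece: `g(w) = β ∘ g(w')`, where `w'` is the remaining trail
(`IsLoopRemoval`). If `w'` is not trivial, then it passes through the vertex where `b` was
attached, so `β` is not maximal. By induction the only maximal piece is the last one, and it
contains the last edge of the trail (`exists_maximals_eq`).

*Injectivity.* The pieces through a vertex `v` form a chain in the heap; the edge out of `v` in the
lowest of them is the *top edge* at `v`. A closed trail runs along top edges of its heap until it
first repeats a vertex (`isTopEdge_of_nodup`). So the base and the heap determine the lasso, hence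
the bottom piece `β` that is removed first; this piece can be cancelled from the heap
(`Iso.of_cons`), and induction determines the rest of the trail (`eq_of_iso_heap`).

*Surjectivity.* Let `p` be any minimal piece of a decomposition pyramid `H`, and let `w'` be a trail
with heap `H` without `p`. It meets `p`, since `p` either is the maximal piece or is covered by a
concurrent piece. Insert `p` into `w'` at the first vertex of `w'` that lies on `p`. The loops that
the recursion removes before it reaches `p` have no vertex on `p`, so their pieces commute with
`p`, and the heap of the new trail is `p ∘ g(w') = H` (`iso_heap_of_insert`,
`exists_closedTrail_of_heap`).

Trails at `u` are in this way in bijection with the decomposition pyramids whose maximal piece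
contains `u`. The last edge of such a trail is the edge of the maximal piece that ends at `u`,
which gives the version with a prescribed last edge.
-/

/-! ### Heaps with a distinguished bottom piece -/

namespace LabelledHeap

variable {B : Type*} {R : Concurrence B}

/-- The heap `b ∘ H`: the piece `b` put below `H`. -/
abbrev cons (b : B) (H : LabelledHeap R) : LabelledHeap R := (single R b).comp H

/-- The added piece of `b ∘ H`. -/
def head (b : B) (H : LabelledHeap R) : (cons b H).Ω := Sum.inl ()

/-- The pieces of `H`, as pieces of `b ∘ H`. -/
def tail (b : B) {H : LabelledHeap R} (x : H.Ω) : (cons b H).Ω := Sum.inr x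

theorem cons_cases {b : B} {H : LabelledHeap R} {P : (cons b H).Ω → Prop}
    (hh : P (head b H)) (ht : ∀ x, P (tail b x)) : ∀ x, P x := by
  rintro (⟨⟩ | x)
  exacts [hh, ht x]

theorem eq_head_or_eq_tail {b : B} {H : LabelledHeap R} :
    ∀ z : (cons b H).Ω, z = head b H ∨ ∃ x, z = tail b x :=
  cons_cases (Or.inl rfl) fun x => Or.inr ⟨x, rfl⟩

@[simp] theorem label_head (b : B) (H : LabelledHeap R) : (cons b H).label (head b H) = b := rfl

theorem tail_injective (b : B) (H : LabelledHeap R) : Function.Injective (tail b (H := H)) :=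
  Sum.inr_injective

@[simp] theorem tail_le_tail {b : B} {H : LabelledHeap R} {x y : H.Ω} :
    tail b x ≤ tail b y ↔ x ≤ y := by
  refine ⟨fun h => ?_, fun h => .single (.right h)⟩
  obtain ⟨z, hz, hxz⟩ := compLE_inr_inr _ _ h
  cases hz
  exact hxz

@[simp] theorem not_tail_le_head {b : B} {H : LabelledHeap R} {x : H.Ω} :
    ¬ tail b x ≤ head b H := by
  intro h
  obtain ⟨z, hz, -⟩ := compLE_inr_inr _ _ h
  cases hz

theorem head_le_tail {b : B} {H : LabelledHeap R} {y : H.Ω} :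
    head b H ≤ tail b y ↔ ∃ x ≤ y, R.Rel b (H.label x) := by
  constructor
  · intro h
    have aux : ∀ z : (cons b H).Ω, CompLE (single R b) H (head b H) z →
        ∀ y : H.Ω, z = tail b y → ∃ x ≤ y, R.Rel b (H.label x) := by
      intro z h
      induction h with
      | single h =>
        rintro y rfl
        cases h with
        | cross h => exact ⟨y, le_rfl, h⟩
      | tail _ h ih =>
        rintro y rfl
        cases h with
        | right h =>
          obtain ⟨x, hx, hR⟩ := ih _ rfl
          exact ⟨x, hx.trans h, hR⟩
        | cross h => exact ⟨y, le_rfl, h⟩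
    exact aux _ h y rfl
  · rintro ⟨x, hx, hR⟩
    exact .tail (.single (.cross hR)) (.right hx)

theorem Iso.of_maps {H₁ H₂ : LabelledHeap R} (f : H₁.Ω → H₂.Ω) (g : H₂.Ω → H₁.Ω)
    (hfg : Function.LeftInverse g f) (hgf : Function.RightInverse g f)
    (hle : ∀ x y, f x ≤ f y ↔ x ≤ y) (hl : ∀ x, H₂.label (f x) = H₁.label x) : Iso H₁ H₂ :=
  ⟨⟨⟨f, g, hfg, hgf⟩, hle _ _⟩, hl⟩

theorem Iso.refl (H : LabelledHeap R) : Iso H H :=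
  (isoSetoid R).refl H

theorem Iso.trans {H₁ H₂ H₃ : LabelledHeap R} (h : Iso H₁ H₂) (h' : Iso H₂ H₃) : Iso H₁ H₃ :=
  (isoSetoid R).trans h h'

theorem mk_eq_mk {H₁ H₂ : LabelledHeap R} : Heaps.mk H₁ = Heaps.mk H₂ ↔ Iso H₁ H₂ :=
  Quotient.eq (r := isoSetoid R)

theorem Iso.cons {H₁ H₂ : LabelledHeap R} (b : B) (h : Iso H₁ H₂) :
    Iso (cons b H₁) (cons b H₂) := by
  obtain ⟨φ, hφ⟩ := h
  refine Iso.of_maps (Sum.map id φ) (Sum.map id φ.symm) ?_ ?_ ?_ ?_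
  · exact cons_cases rfl fun x => congrArg Sum.inr (φ.symm_apply_apply x)
  · exact cons_cases rfl fun x => congrArg Sum.inr (φ.apply_symm_apply x)
  · refine cons_cases (cons_cases (iff_of_true le_rfl le_rfl) fun y => ?_)
      fun x => cons_cases (iff_of_false not_tail_le_head not_tail_le_head) fun y => ?_
    · refine head_le_tail.trans (Iff.trans ?_ head_le_tail.symm)
      constructor
      · rintro ⟨x, hx, hR⟩
        refine ⟨φ.symm x, φ.symm_apply_le.2 hx, ?_⟩
        rwa [← hφ, φ.apply_symm_apply]
      · rintro ⟨x, hx, hR⟩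
        exact ⟨φ x, φ.le_iff_le.2 hx, by rwa [hφ]⟩
    · exact tail_le_tail.trans (φ.le_iff_le.trans tail_le_tail.symm)
  · exact cons_cases rfl hφ

/-- Pieces that are not concurrent commute. -/
theorem iso_cons_cons {a b : B} (hab : ¬ R.Rel a b) (H : LabelledHeap R) :
    Iso (cons a (cons b H)) (cons b (cons a H)) := by
  have hba : ¬ R.Rel b a := fun h => hab (R.symm _ _ h)
  have key : ∀ {a b : B}, ¬ R.Rel a b → ∀ y : H.Ω,
      head a (cons b H) ≤ tail a (tail b y) ↔ ∃ x ≤ y, R.Rel a (H.label x) := by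
    intro a b hab y
    rw [head_le_tail]
    constructor
    · rintro ⟨z, hz, hR⟩
      obtain rfl | ⟨x, rfl⟩ := eq_head_or_eq_tail z
      · exact absurd hR hab
      · exact ⟨x, tail_le_tail.1 hz, hR⟩
    · rintro ⟨x, hx, hR⟩
      exact ⟨tail b x, tail_le_tail.2 hx, hR⟩
  have key' : ∀ {a b : B}, ¬ R.Rel a b → ¬ head a (cons b H) ≤ tail a (head b H) := by
    intro a b hab h
    obtain ⟨z, hz, hR⟩ := head_le_tail.1 h
    obtain rfl | ⟨x, rfl⟩ := eq_head_or_eq_tail z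
    · exact hab hR
    · exact not_tail_le_head hz
  refine Iso.of_maps
    (Sum.elim (fun _ => tail b (head a H)) (Sum.elim (fun _ => head b _) fun x => tail b (tail a x)))
    (Sum.elim (fun _ => tail a (head b H)) (Sum.elim (fun _ => head a _) fun x => tail a (tail b x)))
    ?_ ?_ ?_ ?_
  · exact cons_cases rfl (cons_cases rfl fun _ => rfl)
  · exact cons_cases rfl (cons_cases rfl fun _ => rfl)
  · refine cons_cases (cons_cases ?_ (cons_cases ?_ fun y => ?_))
      (cons_cases (cons_cases ?_ (cons_cases ?_ fun y => ?_))
        fun x => cons_cases ?_ (cons_cases ?_ fun y => ?_))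
    · exact iff_of_true le_rfl le_rfl
    · exact iff_of_false not_tail_le_head (key' hab)
    · exact tail_le_tail.trans (head_le_tail.trans (key hab y).symm)
    · exact iff_of_false (key' hba) not_tail_le_head
    · exact iff_of_true le_rfl le_rfl
    · exact (key hba y).trans (head_le_tail.symm.trans tail_le_tail.symm)
    · exact iff_of_false (fun h => not_tail_le_head (tail_le_tail.1 h)) not_tail_le_head
    · exact iff_of_false not_tail_le_head (fun h => not_tail_le_head (tail_le_tail.1 h))
    · exact tail_le_tail.trans (tail_le_tail.trans (tail_le_tail.trans tail_le_tail).symm)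
  · exact cons_cases rfl (cons_cases rfl fun _ => rfl)

/-- A bottom piece whose label occurs nowhere else can be cancelled. -/
theorem Iso.of_cons {b : B} {H₁ H₂ : LabelledHeap R} (h₁ : ∀ x, H₁.label x ≠ b)
    (h₂ : ∀ x, H₂.label x ≠ b) (h : Iso (LabelledHeap.cons b H₁) (LabelledHeap.cons b H₂)) :
    Iso H₁ H₂ := by
  obtain ⟨φ, hφ⟩ := h
  have aux : ∀ x : H₁.Ω, ∃ y : H₂.Ω, φ (tail b x) = tail b y := by
    intro x
    have hl := hφ (tail b x)
    refine (eq_head_or_eq_tail _).resolve_left fun hz => h₁ x ?_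
    rw [hz] at hl
    exact hl.symm
  have aux' : ∀ y : H₂.Ω, ∃ x : H₁.Ω, φ.symm (tail b y) = tail b x := by
    intro y
    have hl := hφ (φ.symm (tail b y))
    refine (eq_head_or_eq_tail _).resolve_left fun hz => h₂ y ?_
    rw [φ.apply_symm_apply, hz] at hl
    exact hl
  choose f hf using aux
  choose g hg using aux'
  refine Iso.of_maps f g ?_ ?_ ?_ ?_
  · intro x
    apply tail_injective b
    rw [← hg, ← hf, φ.symm_apply_apply]
  · intro y
    apply tail_injective b
    rw [← hf, ← hg, φ.apply_symm_apply]
  · intro x y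
    rw [← tail_le_tail (b := b), ← hf, ← hf, φ.le_iff_le, tail_le_tail]
  · intro x
    have := hφ (tail b x)
    rwa [hf] at this

/-- The heap `H` without its minimal piece `p`. -/
def erase (H : LabelledHeap R) (p : H.Ω) (hp : IsMin p) : LabelledHeap R where
  Ω := {x : H.Ω // x ≠ p}
  label x := H.label x
  comparable x y := H.comparable x y
  concurrent x y h := by
    refine H.concurrent x y ⟨h.1, fun z hxz hzy => ?_⟩
    -- the complement of a minimal element is an upper set
    have hz : z ≠ p := by
      rintro rfl
      exact hp.not_lt hxz
    exact h.2 (c := ⟨z, hz⟩) hxz hzy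

theorem iso_cons_erase (H : LabelledHeap R) (p : H.Ω) (hp : IsMin p) :
    Iso (cons (H.label p) (H.erase p hp)) H := by
  classical
  refine Iso.of_maps (Sum.elim (fun _ => p) Subtype.val)
    (fun x => if h : x = p then head _ _ else tail _ (H := H.erase p hp) ⟨x, h⟩) ?_ ?_ ?_ ?_
  · exact cons_cases (dif_pos rfl) fun x => dif_neg x.2
  · intro x
    by_cases h : x = p
    · simp only [dif_pos h]
      exact h.symm
    · simp only [dif_neg h]
      rfl
  · refine cons_cases (cons_cases (iff_of_true le_rfl le_rfl) fun y => ?_)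
      fun x => cons_cases (iff_of_false ?_ not_tail_le_head) fun y =>
        (tail_le_tail (H := H.erase p hp)).symm
    · rw [head_le_tail]
      constructor
      · intro h
        obtain ⟨z, hpz, hzy⟩ := exists_covBy_le_of_lt (lt_of_le_of_ne h y.2.symm)
        exact ⟨⟨z, hpz.ne'⟩, hzy, H.concurrent _ _ hpz⟩
      · rintro ⟨x, hx, hR⟩
        have hx' : x.1 ≤ y.1 := hx
        exact ((H.comparable _ _ hR).elim id fun h => hp h).trans hx'
    · intro h
      exact x.2 (hp.eq_of_le h)
  · exact cons_cases rfl fun _ => rfl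

theorem isMax_of_isMax_erase {H : LabelledHeap R} {p : H.Ω} {hp : IsMin p}
    {x : (H.erase p hp).Ω} (hx : IsMax x) : IsMax x.1 := by
  intro z hz
  have hzp : z ≠ p := by
    rintro rfl
    exact x.2 (hp.eq_of_le hz)
  exact hx (b := ⟨z, hzp⟩) hz

/-- A bottom piece that is concurrent with some other piece is not maximal. -/
theorem maximals_cons {b : B} {H : LabelledHeap R} {y : H.Ω} (hy : R.Rel b (H.label y)) :
    (cons b H).maximals = tail b '' H.maximals := by
  ext z
  constructor
  · revert z
    refine cons_cases (fun h => ?_) fun x h => ⟨x, fun y hxy => ?_, rfl⟩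
    · exact absurd (h (head_le_tail.2 ⟨y, le_rfl, hy⟩)) not_tail_le_head
    · exact tail_le_tail.1 (h (tail_le_tail.2 hxy))
  · rintro ⟨x, hx, rfl⟩
    exact cons_cases (fun h => absurd h not_tail_le_head)
      fun y h => tail_le_tail.2 (hx (tail_le_tail.1 h))

theorem maximals_cons_of_isEmpty {b : B} {H : LabelledHeap R} [IsEmpty H.Ω] :
    (cons b H).maximals = {head b H} := by
  have h : ∀ z : (cons b H).Ω, z = head b H := cons_cases rfl isEmptyElim
  ext z
  exact iff_of_true (fun y _ => (h y).trans_le (h z).ge) (h z)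

end LabelledHeap

namespace MultiDigraph

variable {V E : Type*} {D : MultiDigraph V E}

open LabelledHeap

/-! ### Walks and cycles -/

/-- The vertices of a walk are the sources of its edges followed by its end, and also its start
followed by the targets of its edges. -/
theorem IsWalk.map_src {u v : V} {l : List E} (h : D.IsWalk u l v) :
    l.map D.src ++ [v] = u :: l.map D.tgt := by
  induction l generalizing u with
  | nil => simpa using Eq.symm h
  | cons e l ih =>
    rw [List.map_cons, List.cons_append, ih h.2, h.1, List.map_cons]

theorem IsWalk.map_src_perm_map_tgt {u : V} {l : List E} (h : D.IsWalk u l u) :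
    (l.map D.src).Perm (l.map D.tgt) :=
  ((List.perm_append_singleton u _).symm.trans (h.map_src ▸ List.Perm.refl _)).cons_inv

theorem IsWalk.mem_map_src {u : V} {l : List E} (h : D.IsWalk u l u) (hl : l ≠ []) :
    u ∈ l.map D.src := by
  cases l with
  | nil => exact absurd rfl hl
  | cons e l => simp [h.1]

theorem IsWalk.tgt_getLast? {u v : V} {l : List E} {e : E} (h : D.IsWalk u l v)
    (he : l.getLast? = some e) : D.tgt e = v := by
  obtain ⟨l', rfl⟩ := List.getLast?_eq_some_iff.1 he
  obtain ⟨x, -, h⟩ := isWalk_append.1 h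
  exact h.2

namespace Piece

theorem mem_edgeSet_iff {β : D.Piece} {b : List E} (h : β.1 = ↑b) {e : E} :
    e ∈ β.edgeSet ↔ e ∈ b := by
  simp [edgeSet, h]

/-- A cycle can be traversed starting from any of its vertices. -/
theorem exists_closedTrail_at (β : D.Piece) {x : V} (hx : x ∈ β.vertexSet) :
    ∃ q : D.ClosedTrail, q.base = x ∧ q.IsSimple ∧ β.1 = ↑q.edges := by
  obtain ⟨c, w, hw, rfl⟩ := β
  obtain ⟨e, he, rfl⟩ := hx
  obtain ⟨l₁, l₂, hl⟩ := List.append_of_mem (Cycle.mem_coe_iff.1 he)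
  have hperm : (l₂ ++ (l₁ ++ [e])).Perm w.edges := by
    rw [hl]
    exact List.perm_append_comm.trans (by simp)
  have hwalk := w.isWalk
  rw [hl] at hwalk
  obtain ⟨y, h₁, h₂⟩ := isWalk_append.1 hwalk
  refine ⟨⟨D.tgt e, l₂ ++ (l₁ ++ [e]), ?_, hperm.nodup_iff.2 w.nodup⟩, rfl, ⟨by simp, ?_⟩, ?_⟩
  · exact isWalk_append.2 ⟨_, h₂.2, isWalk_append.2 ⟨y, h₁, h₂.1, rfl⟩⟩
  · exact (hperm.map D.tgt).nodup_iff.2 hw.2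
  · refine Cycle.coe_eq_coe.2 ?_
    have hrot : ((l₁ ++ [e]) ++ l₂).IsRotated (l₂ ++ (l₁ ++ [e])) := List.isRotated_append
    rwa [List.append_assoc, List.singleton_append, ← hl] at hrot

theorem exists_closedTrail (β : D.Piece) :
    ∃ q : D.ClosedTrail, q.IsSimple ∧ β.1 = ↑q.edges := by
  obtain ⟨c, w, hw, rfl⟩ := β
  exact ⟨w, hw, rfl⟩

theorem tgt_injOn (β : D.Piece) : Set.InjOn D.tgt β.edgeSet := by
  obtain ⟨q, hq, hβ⟩ := β.exists_closedTrail
  intro e he f hf h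
  exact List.inj_on_of_nodup_map hq.2 ((mem_edgeSet_iff hβ).1 he) ((mem_edgeSet_iff hβ).1 hf) h

theorem src_injOn (β : D.Piece) : Set.InjOn D.src β.edgeSet := by
  obtain ⟨q, hq, hβ⟩ := β.exists_closedTrail
  intro e he f hf h
  exact List.inj_on_of_nodup_map (q.isWalk.map_src_perm_map_tgt.nodup_iff.2 hq.2)
    ((mem_edgeSet_iff hβ).1 he) ((mem_edgeSet_iff hβ).1 hf) h

theorem mem_vertexSet_iff {β : D.Piece} {v : V} :
    v ∈ β.vertexSet ↔ ∃ e ∈ β.edgeSet, D.src e = v := by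
  obtain ⟨q, hq, hβ⟩ := β.exists_closedTrail
  have := q.isWalk.map_src_perm_map_tgt.mem_iff (a := v)
  simp only [List.mem_map] at this
  simp only [vertexSet, edgeSet, Set.mem_ofPred_eq, hβ, Cycle.mem_coe_iff, this]

theorem src_mem_vertexSet {β : D.Piece} {e : E} (he : e ∈ β.edgeSet) : D.src e ∈ β.vertexSet :=
  mem_vertexSet_iff.2 ⟨e, he, rfl⟩

theorem tgt_mem_vertexSet {β : D.Piece} {e : E} (he : e ∈ β.edgeSet) : D.tgt e ∈ β.vertexSet :=
  ⟨e, he, rfl⟩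

theorem mem_vertexSet_iff_mem_map {β : D.Piece} {b : List E} (h : β.1 = ↑b) {v : V} :
    v ∈ β.vertexSet ↔ v ∈ b.map D.src := by
  simp only [mem_vertexSet_iff, mem_edgeSet_iff h, List.mem_map]

end Piece

/-! ### Lassos: the initial segment of a trail up to its first repeated vertex -/

/-- The walk `a ++ b` from `u` is a lasso: `a` leads to a vertex `x`, and `b` leads from `x` back
to `x`, which is the first repetition of a vertex. The vertices met before the end of a walk are
the sources of its edges, so this last condition says that these sources are distinct. -/
def IsLasso (D : MultiDigraph V E) (u : V) (a b : List E) : Prop :=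
  ∃ x, D.IsWalk u a x ∧ D.IsWalk x b x ∧ b ≠ [] ∧ ((a ++ b).map D.src).Nodup

/-- If a walk `l` continued by `d` returns to its end `x`, and by `l'` returns to `x` once more,
without two edges out of the same vertex, then `d` is empty. -/
theorem eq_nil_of_isWalk_append {u x : V} {l l' d : List E} (hl : D.IsWalk u l x)
    (hd : D.IsWalk u (l ++ d) x) (hnd : ((l ++ d ++ l').map D.src).Nodup) (hl' : l' ≠ [])
    (hw : D.IsWalk x l' x) : d = [] := by
  by_contra hne
  obtain ⟨y, hly, hd⟩ := isWalk_append.1 hd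
  obtain rfl := hl.unique hly
  rw [List.map_append, List.nodup_append'] at hnd
  refine hnd.2.2 ?_ (hw.mem_map_src hl')
  simp only [List.map_append, List.mem_append]
  exact Or.inr (hd.mem_map_src hne)

/-- A walk has at most one initial lasso. -/
theorem IsLasso.unique {u : V} {a b a' b' : List E} (h : D.IsLasso u a b)
    (h' : D.IsLasso u a' b') (hp : a ++ b <+: a' ++ b') : a = a' ∧ b = b' := by
  obtain ⟨x, ha, hb, hne, -⟩ := h
  obtain ⟨x', ha', hb', hne', hnd'⟩ := h'
  obtain ⟨d, hd⟩ := hp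
  have hwalk : D.IsWalk u (a ++ b) x := isWalk_append.2 ⟨x, ha, hb⟩
  have hwalk' : D.IsWalk u (a' ++ b') x' := isWalk_append.2 ⟨x', ha', hb'⟩
  -- no edge of a lasso leaves a vertex where a loop has just been closed
  have hd0 : d = [] := by
    by_contra hne''
    rw [← hd] at hwalk' hnd'
    obtain ⟨y, hy, hdw⟩ := isWalk_append.1 hwalk'
    obtain rfl := hwalk.unique hy
    rw [List.map_append, List.nodup_append'] at hnd'
    obtain ⟨e, d', rfl⟩ := List.exists_cons_of_ne_nil hne''
    refine hnd'.2.2 (?_ : x ∈ _) (by simp [hdw.1])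
    rw [List.map_append, List.mem_append]
    exact Or.inr (hb.mem_map_src hne)
  subst hd0
  rw [List.append_nil] at hd
  rw [← hd] at hwalk'
  obtain rfl := hwalk.unique hwalk'
  obtain ⟨c, hc, hc'⟩ | ⟨c, hc, hc'⟩ := List.append_eq_append_iff.1 hd
  · subst hc hc'
    have := eq_nil_of_isWalk_append ha ha' hnd' hne' hb'
    simp [this]
  · subst hc hc'
    rw [← hd] at hnd'
    have := eq_nil_of_isWalk_append ha' ha hnd' hne hb
    simp [this]

/-- If the walk `a ++ b ++ c` has an initial lasso `a ++ b`, then every initial segment of it with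
distinct sources lies in `a ++ b`. -/
theorem IsLasso.exists_append_eq {u v : V} {a b c l l' : List E} (h : D.IsLasso u a b)
    (hw : D.IsWalk u (a ++ b ++ c) v) (heq : a ++ b ++ c = l ++ l') (hl : (l.map D.src).Nodup) :
    ∃ d, a ++ b = l ++ d := by
  obtain ⟨x, ha, hb, hne, -⟩ := h
  obtain ⟨d, hd, hd'⟩ | ⟨d, hd, hd'⟩ := List.append_eq_append_iff.1 heq
  · rcases d with - | ⟨e, d⟩
    · exact ⟨[], by simp [hd]⟩
    · exfalso
      subst hd hd'
      obtain ⟨y, hy, hd⟩ := isWalk_append.1 hw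
      obtain rfl := (isWalk_append.2 ⟨x, ha, hb⟩ : D.IsWalk u (a ++ b) x).unique hy
      rw [List.map_append, List.nodup_append'] at hl
      refine hl.2.2 (?_ : x ∈ _) (by simp [hd.1])
      rw [List.map_append, List.mem_append]
      exact Or.inr (hb.mem_map_src hne)
  · exact ⟨d, hd⟩

namespace ClosedTrail

/-- The representative `β₁ ∘ ⋯ ∘ βₘ` of `g(w)`. -/
noncomputable abbrev heap (w : D.ClosedTrail) : LabelledHeap D.concurrence :=
  compList D.concurrence w.cycleSeq

/-- The trail `w` has the edges `a ++ b ++ c` with initial lasso `a ++ b`, the cycle of `b` is `β`,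
and `w'` is the trail with the edges `a ++ c`: one step of the recursion for the cycle sequence. -/
structure IsLoopRemoval (w : D.ClosedTrail) (a b c : List E) (β : D.Piece)
    (w' : D.ClosedTrail) : Prop where
  edges_eq : w.edges = a ++ b ++ c
  lasso : D.IsLasso w.base a b
  piece_eq : β.1 = ↑b
  base_eq : w'.base = w.base
  edges_eq' : w'.edges = a ++ c
  cycleSeq_eq : w.cycleSeq = β :: w'.cycleSeq

theorem vertexAt_eq_src (w : D.ClosedTrail) {k : ℕ} (hk : k < w.edges.length) :
    D.vertexAt w.base w.edges k = D.src w.edges[k] := by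
  rw [vertexAt, ← w.isWalk.map_src]
  simp [List.getElem?_append_left, hk]

theorem exists_isLoopRemoval (w : D.ClosedTrail) (hw : w.edges ≠ []) :
    ∃ a b c β w', w.IsLoopRemoval a b c β w' := by
  have hst := (w.s_lt_t hw).le
  have htake : w.edges.take (w.s hw) ++ (w.edges.take (w.t hw)).drop (w.s hw)
      = w.edges.take (w.t hw) := by
    conv_rhs => rw [← List.take_append_drop (w.s hw) (w.edges.take (w.t hw)),
      List.take_take, min_eq_left hst]
  refine ⟨w.edges.take (w.s hw), (w.edges.take (w.t hw)).drop (w.s hw), w.edges.drop (w.t hw),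
    (w.firstLoop hw).toPiece (w.firstLoop_isSimple hw), w.remainder hw, ?_, ?_, rfl, rfl, rfl, ?_⟩
  · rw [htake, List.take_append_drop]
  · refine ⟨_, w.isWalk.take (w.s_le_length hw), (w.firstLoop hw).isWalk,
      (w.firstLoop_isSimple hw).1, ?_⟩
    rw [htake, List.nodup_iff_pairwise_ne, List.pairwise_iff_getElem]
    intro i j hi hj hij
    simp only [List.length_map, List.length_take, lt_min_iff] at hi hj
    simp only [List.getElem_map, List.getElem_take]
    rw [← w.vertexAt_eq_src hi.2, ← w.vertexAt_eq_src hj.2]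
    exact fun h => w.t_min hw hj.1 ⟨hj.2.le, i, hij, h⟩
  · rw [cycleSeq, dif_neg hw]

theorem exists_isLoopRemoval_of_isLasso {w : D.ClosedTrail} {a b c : List E}
    (hl : D.IsLasso w.base a b) (hw : w.edges = a ++ b ++ c) :
    ∃ β w', w.IsLoopRemoval a b c β w' := by
  obtain ⟨a', b', c', β, w', h⟩ := w.exists_isLoopRemoval (by simp [hw, hl.choose_spec.2.2.1])
  have heq : a ++ b ++ c = a' ++ b' ++ c' := hw.symm.trans h.edges_eq
  have key : a = a' ∧ b = b' := by
    rcases List.prefix_or_prefix_of_prefix (List.prefix_append (a ++ b) c)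
      (heq ▸ List.prefix_append (a' ++ b') c') with hp | hp
    · exact hl.unique h.lasso hp
    · exact (h.lasso.unique hl hp).imp Eq.symm Eq.symm
  obtain ⟨rfl, rfl⟩ := key
  obtain rfl := List.append_cancel_left heq
  exact ⟨β, w', h⟩

namespace IsLoopRemoval

variable {w w' : D.ClosedTrail} {a b c : List E} {β : D.Piece}

theorem heap_eq (h : w.IsLoopRemoval a b c β w') : w.heap = cons β w'.heap := by
  rw [heap, h.cycleSeq_eq]
  rfl

theorem ne_nil (h : w.IsLoopRemoval a b c β w') : b ≠ [] :=
  h.lasso.choose_spec.2.2.1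

theorem length_lt (h : w.IsLoopRemoval a b c β w') : w'.edges.length < w.edges.length := by
  have := List.length_pos_iff.2 h.ne_nil
  simp only [h.edges_eq, h.edges_eq', List.length_append]
  omega

theorem mem_edges_iff (h : w.IsLoopRemoval a b c β w') {e : E} :
    e ∈ w.edges ↔ e ∈ β.edgeSet ∨ e ∈ w'.edges := by
  simp only [h.edges_eq, h.edges_eq', Piece.mem_edgeSet_iff h.piece_eq, List.mem_append]
  tauto

theorem notMem_edges (h : w.IsLoopRemoval a b c β w') {e : E} (he : e ∈ β.edgeSet) :
    e ∉ w'.edges := by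
  have hnd := w.nodup
  rw [h.edges_eq] at hnd
  rw [Piece.mem_edgeSet_iff h.piece_eq] at he
  rw [h.edges_eq']
  simp only [List.nodup_append', List.mem_append] at hnd ⊢
  rintro (ha | hc)
  · exact hnd.1.2.2 ha he
  · exact hnd.2.2 (List.mem_append_right _ he) hc

/-- The loop is attached to the remainder at the vertex where the remainder continues after it. -/
theorem exists_eq_cons (h : w.IsLoopRemoval a b c β w') (hw' : w'.edges ≠ []) :
    ∃ e c', c = e :: c' ∧ D.src e ∈ β.vertexSet := by
  obtain ⟨x, ha, hb, hne, hnd⟩ := h.lasso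
  have hwalk := w.isWalk
  rw [h.edges_eq] at hwalk
  obtain ⟨y, hy, hc⟩ := isWalk_append.1 hwalk
  obtain rfl := (isWalk_append.2 ⟨x, ha, hb⟩ : D.IsWalk w.base (a ++ b) x).unique hy
  rcases c with - | ⟨e, c⟩
  · -- the loop closes at the base, so nothing precedes it
    exfalso
    obtain rfl : x = w.base := hc
    have hane : a ≠ [] := by simpa [h.edges_eq'] using hw'
    rw [List.map_append, List.nodup_append'] at hnd
    exact hnd.2.2 (ha.mem_map_src hane) (hb.mem_map_src hne)
  · refine ⟨e, c, rfl, ?_⟩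
    rw [Piece.mem_vertexSet_iff_mem_map h.piece_eq, hc.1]
    exact hb.mem_map_src hne

end IsLoopRemoval

theorem induction {P : D.ClosedTrail → Prop} (nil : ∀ w, w.edges = [] → P w)
    (step : ∀ w a b c β w', w.IsLoopRemoval a b c β w' → P w' → P w) (w : D.ClosedTrail) :
    P w := by
  induction hn : w.edges.length using Nat.strong_induction_on generalizing w with
  | _ n ih =>
    by_cases hw : w.edges = []
    · exact nil w hw
    · obtain ⟨a, b, c, β, w', h⟩ := w.exists_isLoopRemoval hw
      exact step w a b c β w' h (ih _ (hn ▸ h.length_lt) w' rfl)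

theorem isEmpty_heap {w : D.ClosedTrail} (hw : w.edges = []) : IsEmpty w.heap.Ω := by
  rw [heap, cycleSeq, dif_pos hw]
  exact inferInstanceAs (IsEmpty Empty)

/-! ### The pieces of the heap of a trail -/

theorem exists_mem_label_iff (w : D.ClosedTrail) (e : E) :
    (∃ x, e ∈ (w.heap.label x).edgeSet) ↔ e ∈ w.edges := by
  induction w using induction with
  | nil w hw =>
    have := isEmpty_heap hw
    simp [hw]
  | step w a b c β w' h ih =>
    rw [h.mem_edges_iff, ← ih, h.heap_eq]
    constructor
    · rintro ⟨x, hx⟩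
      obtain rfl | ⟨x, rfl⟩ := eq_head_or_eq_tail x
      · exact Or.inl hx
      · exact Or.inr ⟨x, hx⟩
    · rintro (he | ⟨x, hx⟩)
      · exact ⟨head _ _, he⟩
      · exact ⟨tail _ x, hx⟩

theorem eq_of_mem_label (w : D.ClosedTrail) {e : E} {x y : w.heap.Ω}
    (hx : e ∈ (w.heap.label x).edgeSet) (hy : e ∈ (w.heap.label y).edgeSet) : x = y := by
  induction w using induction with
  | nil w hw => exact (isEmpty_heap hw).elim x
  | step w a b c β w' h ih =>
    revert x y
    rw [h.heap_eq]
    intro x y hx hy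
    obtain rfl | ⟨x, rfl⟩ := eq_head_or_eq_tail x <;> obtain rfl | ⟨y, rfl⟩ := eq_head_or_eq_tail y
    · rfl
    · exact absurd ((w'.exists_mem_label_iff e).1 ⟨y, hy⟩) (h.notMem_edges hx)
    · exact absurd ((w'.exists_mem_label_iff e).1 ⟨x, hx⟩) (h.notMem_edges hy)
    · exact congrArg _ (ih hx hy)

theorem IsEulerian.isDecomposition {w : D.ClosedTrail} (hw : w.IsEulerian) :
    IsDecomposition w.heap := by
  intro e
  obtain ⟨x, hx⟩ := (w.exists_mem_label_iff e).2 (hw e)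
  exact ⟨x, hx, fun y hy => w.eq_of_mem_label hy hx⟩

/-- The heap of a trail is a pyramid, and its maximal piece contains the last edge. -/
theorem exists_maximals_eq (w : D.ClosedTrail) {e : E} (he : w.edges.getLast? = some e) :
    ∃ z, w.heap.maximals = {z} ∧ e ∈ (w.heap.label z).edgeSet := by
  induction w using induction with
  | nil w hw => simp [hw] at he
  | step w a b c β w' h ih =>
    rw [h.heap_eq]
    by_cases hw' : w'.edges = []
    · have := isEmpty_heap hw'
      refine ⟨head _ _, maximals_cons_of_isEmpty, ?_⟩
      have hmem := List.mem_of_getLast? he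
      rwa [h.mem_edges_iff, hw', or_iff_left (by simp)] at hmem
    · obtain ⟨f, c', rfl, hf⟩ := h.exists_eq_cons hw'
      obtain ⟨z, hz, hez⟩ := ih (by simpa [h.edges_eq, h.edges_eq', List.getLast?_append] using he)
      obtain ⟨y, hy⟩ := (w'.exists_mem_label_iff f).2 (by simp [h.edges_eq'])
      refine ⟨tail _ z, ?_, hez⟩
      rw [maximals_cons (y := y) ⟨_, hf, Piece.src_mem_vertexSet hy⟩, hz, Set.image_singleton]

end ClosedTrail

/-! ### Top edges and injectivity -/

/-- The edge `f` lies in the lowest piece of `H` through its source. (With pieces removed from the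
bottom of the heap, this is the first edge out of `src f` to be used.) -/
def IsTopEdge (H : LabelledHeap D.concurrence) (f : E) : Prop :=
  ∃ x, f ∈ (H.label x).edgeSet ∧ ∀ y, D.src f ∈ (H.label y).vertexSet → x ≤ y

/-- At most one top edge leaves a given vertex. -/
theorem IsTopEdge.eq {H : LabelledHeap D.concurrence} {e f : E} (he : IsTopEdge H e)
    (hf : IsTopEdge H f) (h : D.src e = D.src f) : e = f := by
  obtain ⟨x, hx, hxmin⟩ := he
  obtain ⟨y, hy, hymin⟩ := hf
  obtain rfl : x = y := le_antisymm (hxmin y (h ▸ Piece.src_mem_vertexSet hy))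
    (hymin x (h ▸ Piece.src_mem_vertexSet hx))
  exact Piece.src_injOn _ hx hy h

theorem IsTopEdge.of_iso {H H' : LabelledHeap D.concurrence} {f : E} (h : Iso H H')
    (hf : IsTopEdge H f) : IsTopEdge H' f := by
  obtain ⟨φ, hφ⟩ := h
  obtain ⟨x, hx, hmin⟩ := hf
  refine ⟨φ x, by rwa [hφ], fun y hy => φ.le_symm_apply.1 (hmin _ ?_)⟩
  rwa [← hφ, φ.apply_symm_apply]

/-- Two walks along top edges from the same vertex agree as long as both last. -/
theorem prefix_or_prefix_of_isTopEdge {H : LabelledHeap D.concurrence} {u v v' : V}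
    {l l' : List E} (h : D.IsWalk u l v) (h' : D.IsWalk u l' v') (hl : ∀ f ∈ l, IsTopEdge H f)
    (hl' : ∀ f ∈ l', IsTopEdge H f) : l <+: l' ∨ l' <+: l := by
  induction l generalizing u l' with
  | nil => exact Or.inl List.nil_prefix
  | cons e l ih =>
    rcases l' with - | ⟨e', l'⟩
    · exact Or.inr List.nil_prefix
    · obtain rfl := (hl e (by simp)).eq (hl' e' (by simp)) (h.1.trans h'.1.symm)
      simp only [List.prefix_cons_inj]
      exact ih h.2 h'.2 (fun f hf => hl f (by simp [hf])) fun f hf => hl' f (by simp [hf])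

namespace ClosedTrail

/-- As long as a closed trail meets no vertex twice, it runs along top edges of its heap. -/
theorem isTopEdge_of_nodup (w : D.ClosedTrail) {l₁ l₂ : List E} {f : E}
    (hw : w.edges = l₁ ++ f :: l₂) (hnd : ((l₁ ++ [f]).map D.src).Nodup) :
    IsTopEdge w.heap f := by
  induction w using induction generalizing l₁ l₂ with
  | nil w hw' => simp [hw'] at hw
  | step w a b c β w' h ih =>
    rw [h.heap_eq]
    have hwalk := w.isWalk
    rw [h.edges_eq] at hwalk
    obtain ⟨d, hd⟩ := h.lasso.exists_append_eq (l := l₁ ++ [f]) (l' := l₂) hwalk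
      (by rw [← h.edges_eq, hw]; simp) hnd
    rw [List.append_assoc, List.singleton_append] at hd
    have hndl := h.lasso.choose_spec.2.2.2
    by_cases hfb : f ∈ b
    · -- an edge of the first loop lies in the bottom piece
      have hfβ := (Piece.mem_edgeSet_iff h.piece_eq).2 hfb
      refine ⟨head _ _, hfβ, fun y hy => ?_⟩
      obtain rfl | ⟨y, rfl⟩ := eq_head_or_eq_tail y
      · exact le_rfl
      · exact head_le_tail.2 ⟨y, le_rfl, _, Piece.src_mem_vertexSet hfβ, hy⟩
    · obtain ⟨z, rfl⟩ : ∃ z, a = l₁ ++ f :: z := by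
        obtain ⟨z, -, hz⟩ | ⟨z, hz, hz'⟩ := List.append_eq_append_iff.1 hd
        · simp [hz] at hfb
        · rcases z with - | ⟨g, z⟩
          · rw [List.nil_append] at hz'
            simp [← hz'] at hfb
          · obtain ⟨rfl, -⟩ := List.cons.inj hz'
            exact ⟨z, hz⟩
      obtain ⟨x, hx, hmin⟩ := ih (l₂ := z ++ c) (by simp [h.edges_eq']) hnd
      refine ⟨tail _ x, hx, fun y hy => ?_⟩
      obtain rfl | ⟨y, rfl⟩ := eq_head_or_eq_tail y
      · exfalso
        rw [label_head, Piece.mem_vertexSet_iff_mem_map h.piece_eq] at hy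
        rw [List.map_append, List.nodup_append'] at hndl
        exact hndl.2.2 (by simp) hy
      · exact tail_le_tail.2 (hmin y hy)

theorem IsLoopRemoval.isTopEdge {w w' : D.ClosedTrail} {a b c : List E} {β : D.Piece}
    (h : w.IsLoopRemoval a b c β w') {f : E} (hf : f ∈ a ++ b) : IsTopEdge w.heap f := by
  obtain ⟨l₁, l₂, hl⟩ := List.append_of_mem hf
  have hnd := h.lasso.choose_spec.2.2.2
  refine w.isTopEdge_of_nodup (l₁ := l₁) (l₂ := l₂ ++ c) (by rw [h.edges_eq, hl]; simp) ?_
  rw [hl, show l₁ ++ f :: l₂ = (l₁ ++ [f]) ++ l₂ by simp, List.map_append] at hnd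
  exact hnd.of_append_left

theorem IsLoopRemoval.label_ne {w w' : D.ClosedTrail} {a b c : List E} {β : D.Piece}
    (h : w.IsLoopRemoval a b c β w') (x : w'.heap.Ω) : w'.heap.label x ≠ β := by
  intro hx
  obtain ⟨e, he⟩ := List.exists_mem_of_ne_nil _ h.ne_nil
  rw [← Piece.mem_edgeSet_iff h.piece_eq] at he
  exact h.notMem_edges he ((w'.exists_mem_label_iff e).1 ⟨x, hx ▸ he⟩)

/-- A closed trail is determined by its base and its heap. -/
theorem eq_of_iso_heap {w v : D.ClosedTrail} (hbase : w.base = v.base)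
    (h : Iso w.heap v.heap) : w = v := by
  induction w using induction generalizing v with
  | nil w hw =>
    refine ClosedTrail.ext hbase ?_
    have := isEmpty_heap hw
    obtain ⟨φ, -⟩ := h
    rw [hw, eq_comm, List.eq_nil_iff_forall_not_mem]
    intro e he
    obtain ⟨x, -⟩ := (v.exists_mem_label_iff e).2 he
    exact this.elim (φ.symm x)
  | step w a b c β w' hr ih =>
    have hv : v.edges ≠ [] := by
      intro hv
      have := isEmpty_heap hv
      obtain ⟨e, he⟩ := List.exists_mem_of_ne_nil _ hr.ne_nil
      obtain ⟨x, -⟩ := (w.exists_mem_label_iff e).2 (by simp [hr.edges_eq, he])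
      obtain ⟨φ, -⟩ := h
      exact this.elim (φ x)
    obtain ⟨a', b', c', β', v', hs⟩ := v.exists_isLoopRemoval hv
    have hl := hr.lasso
    have hl' := hs.lasso
    rw [← hbase] at hl'
    have key : a = a' ∧ b = b' := by
      obtain ⟨x, ha, hb, -, -⟩ := hl
      obtain ⟨x', ha', hb', -, -⟩ := hl'
      rcases prefix_or_prefix_of_isTopEdge (isWalk_append.2 ⟨x, ha, hb⟩)
        (isWalk_append.2 ⟨x', ha', hb'⟩) (fun f hf => (hr.isTopEdge hf).of_iso h)
        (fun f hf => hs.isTopEdge hf) with hp | hp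
      · exact hr.lasso.unique (hbase ▸ hs.lasso) hp
      · exact (hs.lasso.unique (hbase ▸ hr.lasso) hp).imp Eq.symm Eq.symm
    obtain ⟨rfl, rfl⟩ := key
    obtain rfl : β = β' := Subtype.ext (hr.piece_eq.trans hs.piece_eq.symm)
    rw [hr.heap_eq, hs.heap_eq] at h
    have hw' : w' = v' := ih (by rw [hr.base_eq, hs.base_eq, hbase])
      (Iso.of_cons hr.label_ne hs.label_ne h)
    have hc : a ++ c = a ++ c' := by rw [← hr.edges_eq', ← hs.edges_eq', hw']
    refine ClosedTrail.ext hbase ?_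
    rw [hr.edges_eq, hs.edges_eq, List.append_cancel_left hc]

/-! ### Insertion of a loop and surjectivity -/

/-- Inserting a cycle `β` into a closed trail at the first vertex of the trail that lies on `β`
puts the piece `β` below the heap of the trail. The inserted loop need not be the first one of the
new trail, but the loops before it have no vertex in common with it. -/
theorem iso_heap_of_insert {w v q : D.ClosedTrail} {β : D.Piece} {l₁ l₂ : List E}
    (hq : q.IsSimple) (hβ : β.1 = ↑q.edges) (hbase : v.base = w.base)
    (hw : w.edges = l₁ ++ l₂) (hv : v.edges = l₁ ++ q.edges ++ l₂)
    (hl : D.IsWalk w.base l₁ q.base) (hfirst : ∀ f ∈ l₁, D.src f ∉ β.vertexSet) :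
    Iso v.heap (cons β w.heap) := by
  induction hn : w.edges.length using Nat.strong_induction_on generalizing w v l₁ with
  | _ n ih =>
    have hsrc : (q.edges.map D.src).Nodup := q.isWalk.map_src_perm_map_tgt.nodup_iff.2 hq.2
    by_cases hnd : (l₁.map D.src).Nodup
    · have hlasso : D.IsLasso v.base l₁ q.edges := by
        refine ⟨q.base, hbase ▸ hl, q.isWalk, hq.1, ?_⟩
        rw [List.map_append, List.nodup_append']
        refine ⟨hnd, hsrc, fun x hx hx' => ?_⟩
        obtain ⟨f, hf, rfl⟩ := List.mem_map.1 hx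
        exact hfirst f hf ((Piece.mem_vertexSet_iff_mem_map hβ).2 hx')
      obtain ⟨β', w', hr⟩ := exists_isLoopRemoval_of_isLasso hlasso hv
      obtain rfl : β' = β := Subtype.ext (hr.piece_eq.trans hβ.symm)
      obtain rfl : w' = w :=
        ClosedTrail.ext (hr.base_eq.trans hbase) (hr.edges_eq'.trans hw.symm)
      rw [hr.heap_eq]
      exact Iso.refl _
    · obtain ⟨a, b, c, γ, w', hr⟩ := w.exists_isLoopRemoval (by
        rintro h0
        rw [hw, List.append_eq_nil_iff] at h0
        simp [h0.1] at hnd)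
      have heq : a ++ b ++ c = l₁ ++ l₂ := hr.edges_eq.symm.trans hw
      obtain ⟨c₁, rfl, rfl⟩ : ∃ c₁, l₁ = a ++ b ++ c₁ ∧ c = c₁ ++ l₂ := by
        obtain h | ⟨d, hd, -⟩ := List.append_eq_append_iff.1 heq
        · exact h
        · have := hr.lasso.choose_spec.2.2.2
          rw [hd, List.map_append] at this
          exact absurd this.of_append_left hnd
      obtain ⟨γ', v', hs⟩ := exists_isLoopRemoval_of_isLasso (w := v) (a := a) (b := b)
        (c := c₁ ++ q.edges ++ l₂) (hbase ▸ hr.lasso) (by simp [hv])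
      obtain rfl : γ' = γ := Subtype.ext (hs.piece_eq.trans hr.piece_eq.symm)
      have hwalk : D.IsWalk w'.base (a ++ c₁) q.base := by
        obtain ⟨x, ha, hb, -, -⟩ := hr.lasso
        obtain ⟨y, hy, hc⟩ := isWalk_append.1 hl
        obtain rfl := (isWalk_append.2 ⟨x, ha, hb⟩ : D.IsWalk w.base (a ++ b) x).unique hy
        rw [hr.base_eq]
        exact isWalk_append.2 ⟨x, ha, hc⟩
      have key := ih _ (hn ▸ hr.length_lt) (w := w') (v := v') (l₁ := a ++ c₁)
        (by rw [hs.base_eq, hr.base_eq, hbase]) (by rw [hr.edges_eq', List.append_assoc])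
        (by simp [hs.edges_eq']) hwalk
        (fun f hf => hfirst f (by simp only [List.mem_append] at hf ⊢; tauto)) rfl
      have hdisj : ¬ D.concurrence.Rel γ' β := by
        rintro ⟨x, hxγ, hxβ⟩
        rw [Piece.mem_vertexSet_iff_mem_map hr.piece_eq] at hxγ
        obtain ⟨f, hf, rfl⟩ := List.mem_map.1 hxγ
        exact hfirst f (by simp [hf]) hxβ
      rw [hs.heap_eq, hr.heap_eq]
      exact (key.cons γ').trans (iso_cons_cons hdisj w'.heap)

end ClosedTrail

/-- A walk that meets `S` can be cut at its first vertex in `S`. -/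
theorem IsWalk.exists_split {u v : V} {l : List E} (h : D.IsWalk u l v) {S : Set V}
    (hS : v ∈ S ∨ ∃ f ∈ l, D.src f ∈ S) :
    ∃ l₁ l₂ x, l = l₁ ++ l₂ ∧ D.IsWalk u l₁ x ∧ x ∈ S ∧ ∀ f ∈ l₁, D.src f ∉ S := by
  induction l generalizing u with
  | nil =>
    obtain rfl : u = v := h
    exact ⟨[], [], u, rfl, rfl, by simpa using hS, by simp⟩
  | cons e l ih =>
    by_cases hu : u ∈ S
    · exact ⟨[], e :: l, u, rfl, rfl, hu, by simp⟩
    · have hne : D.src e ∉ S := h.1 ▸ hu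
      obtain ⟨l₁, l₂, x, rfl, hw, hx, hl⟩ := ih h.2 (by simpa [hne] using hS)
      exact ⟨e :: l₁, l₂, x, rfl, ⟨h.1, hw⟩, hx, by simpa [hne] using hl⟩

/-- A heap with edge-disjoint pieces and at most one maximal piece is the heap of a closed trail
at any vertex of its maximal piece. The empty heap is allowed, for the sake of the induction. -/
theorem exists_closedTrail_of_heap (H : LabelledHeap D.concurrence) (u : V)
    (hdisj : ∀ e x y, e ∈ (H.label x).edgeSet → e ∈ (H.label y).edgeSet → x = y)
    (hsub : ∀ x y : H.Ω, IsMax x → IsMax y → x = y)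
    (hu : ∀ x : H.Ω, IsMax x → u ∈ (H.label x).vertexSet) :
    ∃ w : D.ClosedTrail, w.base = u ∧ Iso w.heap H := by
  induction hn : Nat.card H.Ω using Nat.strong_induction_on generalizing H with
  | _ n ih =>
  rcases isEmpty_or_nonempty H.Ω with hH | ⟨⟨x₀⟩⟩
  · let w : D.ClosedTrail := ⟨u, [], rfl, List.nodup_nil⟩
    have : IsEmpty w.heap.Ω := ClosedTrail.isEmpty_heap rfl
    exact ⟨w, rfl, Iso.of_maps isEmptyElim isEmptyElim isEmptyElim isEmptyElim isEmptyElim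
      isEmptyElim⟩
  obtain ⟨p, -, hp⟩ := Finite.exists_le_minimal (p := fun _ : H.Ω => True) (a := x₀) trivial
  replace hp : IsMin p := fun y hy => hp.2 trivial hy
  obtain ⟨w, hwu, hw⟩ := ih (Nat.card (H.erase p hp).Ω)
    (hn ▸ Finite.card_subtype_lt (p := fun x => x ≠ p) (x := p) (by simp)) (H.erase p hp)
    (fun e x y hx hy => Subtype.ext (hdisj e x.1 y.1 hx hy))
    (fun x y hx hy => Subtype.ext (hsub _ _ (isMax_of_isMax_erase hx) (isMax_of_isMax_erase hy)))
    (fun x hx => hu _ (isMax_of_isMax_erase hx)) rfl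
  have hlabel : ∀ e ∈ w.edges, ∃ y ≠ p, e ∈ (H.label y).edgeSet := by
    intro e he
    obtain ⟨x, hx⟩ := (w.exists_mem_label_iff e).2 he
    obtain ⟨φ, hφ⟩ := hw
    rw [← hφ] at hx
    exact ⟨(φ x).1, (φ x).2, hx⟩
  have hmeet : w.base ∈ (H.label p).vertexSet ∨
      ∃ f ∈ w.edges, D.src f ∈ (H.label p).vertexSet := by
    by_cases hpm : IsMax p
    · exact Or.inl (hwu ▸ hu p hpm)
    · obtain ⟨y, hpy⟩ := not_isMax_iff.1 hpm
      obtain ⟨z, hpz, -⟩ := exists_covBy_le_of_lt hpy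
      obtain ⟨x, hxp, hxz⟩ := H.concurrent _ _ hpz
      obtain ⟨f, hf, rfl⟩ := Piece.mem_vertexSet_iff.1 hxz
      obtain ⟨φ, hφ⟩ := hw
      let z' : (H.erase p hp).Ω := ⟨z, hpz.ne'⟩
      refine Or.inr ⟨f, (w.exists_mem_label_iff f).1 ⟨φ.symm z', ?_⟩, hxp⟩
      rw [← hφ, φ.apply_symm_apply]
      exact hf
  obtain ⟨l₁, l₂, x, hl, hwalk, hx, hfirst⟩ := w.isWalk.exists_split hmeet
  obtain ⟨q, rfl, hq, hβ⟩ := (H.label p).exists_closedTrail_at hx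
  have hwalk₂ : D.IsWalk q.base l₂ w.base := by
    have h := w.isWalk
    rw [hl] at h
    obtain ⟨y, hy, h⟩ := isWalk_append.1 h
    rwa [hwalk.unique hy]
  have hnd : (l₁ ++ q.edges ++ l₂).Nodup := by
    have hperm : (l₁ ++ q.edges ++ l₂).Perm (q.edges ++ (l₁ ++ l₂)) := by
      rw [← List.append_assoc]
      exact List.perm_append_comm.append_right _
    rw [hperm.nodup_iff, ← hl, List.nodup_append']
    refine ⟨q.nodup, w.nodup, fun e he he' => ?_⟩
    obtain ⟨y, hyp, hy⟩ := hlabel e he'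
    exact hyp (hdisj e y p hy ((Piece.mem_edgeSet_iff hβ).2 he))
  let v : D.ClosedTrail := ⟨w.base, l₁ ++ q.edges ++ l₂,
    isWalk_append.2 ⟨_, isWalk_append.2 ⟨_, hwalk, q.isWalk⟩, hwalk₂⟩, hnd⟩
  refine ⟨v, hwu, ?_⟩
  have hv : Iso v.heap (LabelledHeap.cons (H.label p) w.heap) :=
    ClosedTrail.iso_heap_of_insert hq hβ rfl hl rfl hwalk hfirst
  exact hv.trans ((hw.cons _).trans (iso_cons_erase H p hp))

/-- A decomposition pyramid is the heap of an Eulerian closed trail at any vertex of its maximal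
piece. -/
theorem IsDecomposition.exists_isEulerian {H : LabelledHeap D.concurrence}
    (hH : IsDecomposition H) {z : H.Ω} (hz : H.maximals = {z}) {u : V}
    (hu : u ∈ (H.label z).vertexSet) :
    ∃ w : D.ClosedTrail, w.IsEulerian ∧ w.base = u ∧ Iso w.heap H := by
  have hmax : ∀ x : H.Ω, IsMax x → x = z := fun x hx => hz.subset hx
  obtain ⟨w, hwu, hw⟩ := exists_closedTrail_of_heap H u
    (fun e x y hx hy => (hH e).unique hx hy) (fun x y hx hy => (hmax x hx).trans (hmax y hy).symm)
    (fun x hx => (hmax x hx) ▸ hu)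
  refine ⟨w, fun e => ?_, hwu, hw⟩
  obtain ⟨x, hx, -⟩ := hH e
  obtain ⟨φ, hφ⟩ := hw
  refine (w.exists_mem_label_iff e).1 ⟨φ.symm x, ?_⟩
  rwa [← hφ, φ.apply_symm_apply]

end MultiDigraph

open MultiDigraph LabelledHeap in
theorem mainTheorem3 {V E : Type*} [Finite V] [Finite E] [Nonempty E]
    (D : MultiDigraph V E) (hconn : D.Connected) (hEuler : D.Eulerian) :
    (∀ w : D.ClosedTrail, w.edges ≠ [] → w.toHeap ∈ pyramids D.concurrence) ∧
    (∀ e : E, Set.BijOn MultiDigraph.ClosedTrail.toHeap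
      (D.eulerianTrailsEndingAt e) (D.decompositionPyramidsEdge e)) ∧
    (∀ u : V, Set.BijOn MultiDigraph.ClosedTrail.toHeap
      (D.eulerianTrailsAt u) (D.decompositionPyramidsVertex u)) := by
  have hne : ∀ w : D.ClosedTrail, w.IsEulerian → w.edges ≠ [] := fun w hw =>
    List.ne_nil_of_mem (hw (Classical.arbitrary E))
  have hlast : ∀ w : D.ClosedTrail, w.edges ≠ [] → ∃ e, w.edges.getLast? = some e :=
    fun w hw => ⟨_, List.getLast?_eq_some_getLast hw⟩
  have hinj : ∀ w v : D.ClosedTrail, w.base = v.base → w.toHeap = v.toHeap → w = v :=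
    fun w v hbase h => ClosedTrail.eq_of_iso_heap hbase (mk_eq_mk.1 h)
  refine ⟨fun w hw => ?_, fun e => ⟨?_, ?_, ?_⟩, fun u => ⟨?_, ?_, ?_⟩⟩
  · obtain ⟨e, he⟩ := hlast w hw
    obtain ⟨z, hz, -⟩ := w.exists_maximals_eq he
    exact ⟨w.heap, rfl, z, hz⟩
  · rintro w ⟨hw, he⟩
    exact ⟨w.heap, rfl, hw.isDecomposition, w.exists_maximals_eq he⟩
  · rintro w ⟨-, hw⟩ v ⟨-, hv⟩ h
    exact hinj w v ((w.isWalk.tgt_getLast? hw).symm.trans (v.isWalk.tgt_getLast? hv)) h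
  · rintro _ ⟨H, rfl, hH, z, hz, he⟩
    obtain ⟨w, hw, hwu, hiso⟩ := hH.exists_isEulerian hz (Piece.tgt_mem_vertexSet he)
    refine ⟨w, ⟨hw, ?_⟩, mk_eq_mk.2 hiso⟩
    -- the last edge of `w` lies in the maximal piece and ends where `e` ends
    obtain ⟨f, hf⟩ := hlast w (hne w hw)
    obtain ⟨z', hz', hfz⟩ := w.exists_maximals_eq hf
    obtain ⟨φ, hφ⟩ := hiso
    have hmax : φ z' ∈ H.maximals := φ.isMax_apply.2 (hz'.superset rfl)
    obtain rfl : φ z' = z := by rwa [hz] at hmax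
    rw [← hφ] at hfz
    rwa [← Piece.tgt_injOn _ hfz he ((w.isWalk.tgt_getLast? hf).trans hwu)]
  · rintro w ⟨hw, rfl⟩
    obtain ⟨e, he⟩ := hlast w (hne w hw)
    obtain ⟨z, hz, hez⟩ := w.exists_maximals_eq he
    refine ⟨w.heap, rfl, hw.isDecomposition, z, hz, ?_⟩
    rw [← w.isWalk.tgt_getLast? he]
    exact Piece.tgt_mem_vertexSet hez
  · rintro w ⟨-, hw⟩ v ⟨-, hv⟩ h
    exact hinj w v (hw.trans hv.symm) h
  · rintro _ ⟨H, rfl, hH, z, hz, hu⟩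
    obtain ⟨w, hw, hwu, hiso⟩ := hH.exists_isEulerian hz hu
    exact ⟨w, ⟨hw, hwu⟩, mk_eq_mk.2 hiso⟩
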